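/- Let $\Sigma$ be a finite alphabet. A word $w \in \Sigma^*$ is a pangram (a perfect pangram) if every letter of $\Sigma$ occurs at least once (exactly once) in $w$. A 2-SPT acceptor over $\Sigma$ is a finite set $F$ of words over $\Sigma$ of length at most $2$; its language $L(F)$ is the set of all $w \in \Sigma^*$ such that no $u \in F$ is a (not necessarily contiguous) subsequence of $w$. The pangram problem (perfect pangram problem) for 2-SPT asks, given $\Sigma$ and $F$, whether $L(F)$ contains a pangram (a perfect pangram). (1) The pangram problem and the perfect pangram problem for 2-SPT can both be solved on a random access machine in $O(|F| + |\Sigma| + 1)$ steps, with all stored numbers of size $O(|F| + |\Sigma| + 1)$. Here the letters of $\Sigma$ are numbered $0, \dots, |\Sigma|-1$, and the words of $F$ are listed in an arbitrary order, each once; the machine can add, subtract, copy, load and store through an address in a register, and branch on zero, each in one step. (2) Let $G_F$ be the directed graph with vertex set $\Sigma$ and an edge $x \to y$ for every word $xy \in F$ with $x \neq y$. Then $L(F)$ contains a pangram if and only if $F$ contains no word of length at most $1$ and $G_F$ is acyclic; and $L(F)$ contains a perfect pangram under exactly the same condition. (3) Under this condition $G_F$ has a reverse topological sort, i.e. a list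 of all letters, each exactly once, in which $x$ comes after $y$ for every edge $x \to y$ of $G_F$; and every reverse topological sort of $G_F$ is a word of $L(F)$ and a perfect pangram (in particular a pangram). -/

import Mathlib

namespace Pangram

/-! ### Pangrams and strictly piecewise acceptors -/

section Languages

variable {α : Type*}

/-- Every letter of the alphabet appears at least once in `w`. -/
def IsPangram (w : List α) : Prop := ∀ a : α, a ∈ w

/-- Every letter of the alphabet appears exactly once in `w`. -/
def IsPerfectPangram [DecidableEq α] (w : List α) : Prop := ∀ a : α, w.count a = 1

/-- The language `L` contains a pangram. -/
def HasPangram (L : Language α) : Prop := ∃ w ∈ L, IsPangram w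

/-- The language `L` contains a perfect pangram. -/
def HasPerfectPangram [DecidableEq α] (L : Language α) : Prop := ∃ w ∈ L, IsPerfectPangram w

/-- A `k`-strictly piecewise language acceptor over `α`: a finite set of forbidden
subsequences, each of length at most `k`. -/
structure SPT (k : ℕ) (α : Type*) where
  forbidden : Finset (List α)
  length_le : ∀ u ∈ forbidden, u.length ≤ k

/-- The words none of whose (not necessarily contiguous) subsequences is forbidden. -/
def SPT.lang {k : ℕ} (A : SPT k α) : Language α :=
  {w | ∀ u ∈ A.forbidden, ¬ u.Sublist w}

/-- The graph of forbidden pairs on the alphabet, without loops: an edge `x → y` for every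
forbidden string `xy` with `x ≠ y`. -/
def SPT.graph {k : ℕ} (A : SPT k α) : Digraph α where
  Adj x y := x ≠ y ∧ [x, y] ∈ A.forbidden

/-- There is no closed walk of positive length. -/
def IsAcyclic (G : Digraph α) : Prop := ∀ x, ¬ Relation.TransGen G.Adj x x

/-- `w` lists every vertex exactly once, and for every edge `x → y` the vertex `x` comes
after `y`. -/
def IsReverseTopologicalSort [DecidableEq α] (G : Digraph α) (w : List α) : Prop :=
  (∀ a : α, w.count a = 1) ∧ ∀ x y : α, G.Adj x y → w.idxOf y < w.idxOf x

end Languages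

/-! ### Random access machines -/

namespace RAM

/-- Instructions of a random access machine with registers `r₀, r₁, …` (named directly) and
a memory (addressed through registers), all of whose cells hold natural numbers. -/
inductive Instr where
  /-- `r_i := c` -/
  | const (i c : ℕ)
  /-- `r_i := r_j` -/
  | move (i j : ℕ)
  /-- `r_i := r_j + r_k` -/
  | add (i j k : ℕ)
  /-- `r_i := r_j - r_k`, or `0` if this is negative -/
  | sub (i j k : ℕ)
  /-- `r_i := mem[r_j]` -/
  | load (i j : ℕ)
  /-- `mem[r_i] := r_j` -/
  | store (i j : ℕ)
  /-- continue with instruction number `l` -/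
  | jump (l : ℕ)
  /-- if `r_i = 0`, continue with instruction number `l` -/
  | jumpIfZero (i l : ℕ)

abbrev Program := List Instr

structure Config where
  pc : ℕ
  reg : ℕ → ℕ
  mem : ℕ → ℕ

/-- The effect of one instruction. -/
def Instr.exec (s : Config) : Instr → Config
  | .const i c => ⟨s.pc + 1, Function.update s.reg i c, s.mem⟩
  | .move i j => ⟨s.pc + 1, Function.update s.reg i (s.reg j), s.mem⟩
  | .add i j k => ⟨s.pc + 1, Function.update s.reg i (s.reg j + s.reg k), s.mem⟩
  | .sub i j k => ⟨s.pc + 1, Function.update s.reg i (s.reg j - s.reg k), s.mem⟩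
  | .load i j => ⟨s.pc + 1, Function.update s.reg i (s.mem (s.reg j)), s.mem⟩
  | .store i j => ⟨s.pc + 1, s.reg, Function.update s.mem (s.reg i) (s.reg j)⟩
  | .jump l => ⟨l, s.reg, s.mem⟩
  | .jumpIfZero i l => ⟨if s.reg i = 0 then l else s.pc + 1, s.reg, s.mem⟩

/-- The machine has halted when the program counter points outside the program. -/
def Halted (p : Program) (s : Config) : Prop := p.length ≤ s.pc

/-- One step of the machine; a halted machine does not move. -/
def step (p : Program) (s : Config) : Config :=
  match p[s.pc]? with
  | some ins => ins.exec s
  | none => s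

/-- The input occupies the first memory cells; everything else is `0`. -/
def initial (input : List ℕ) : Config := ⟨0, fun _ => 0, fun a => input.getD a 0⟩

/-- The configuration after `t` steps. -/
def run (p : Program) (input : List ℕ) (t : ℕ) : Config := (step p)^[t] (initial input)

/-- All numbers stored in registers and memory are at most `B`. -/
def Config.BoundedBy (s : Config) (B : ℕ) : Prop := (∀ i, s.reg i ≤ B) ∧ ∀ a, s.mem a ≤ B

/-- A decision problem `Q` on instances of type `ι`, where `code x` is the set of lists of
numbers that represent the instance `x`, is solvable in linear time with respect to `size`:
one program decides `Q x` from every representation of `x` (leaving a nonzero number in `r₀`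
exactly when `Q x` holds) in `O(size x + 1)` steps. To keep unit cost honest, all numbers
that occur have to stay `O(size x + 1)`, so that they fit into words of logarithmic length. -/
def SolvableInLinearTime {ι : Type*} (code : ι → Set (List ℕ)) (size : ι → ℕ)
    (Q : ι → Prop) : Prop :=
  ∃ (p : Program) (C : ℕ), ∀ x : ι, ∀ input ∈ code x, ∃ t ≤ C * (size x + 1),
    Halted p (run p input t) ∧
    ((run p input t).reg 0 ≠ 0 ↔ Q x) ∧
    ∀ s ≤ t, (run p input s).BoundedBy (C * (size x + 1))

end RAM

/-! ### The pangram problems as computational problems -/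

/-- An instance of the (perfect) pangram problem for `k`-SPT: a finite alphabet, whose letters
are numbered `0, …, n - 1`, and an acceptor over it. -/
structure Instance (k : ℕ) where
  n : ℕ
  acceptor : SPT k (Fin n)

/-- The size `|F| + |Σ|`. -/
def Instance.size {k : ℕ} (x : Instance k) : ℕ := x.acceptor.forbidden.card + x.n

/-- A word is written as its length followed by its letters. -/
def encodeWord {n : ℕ} (u : List (Fin n)) : List ℕ := u.length :: u.map Fin.val

/-- The alphabet size, the number of words, and then the words one after the other. -/
def encodeWords (n : ℕ) (ws : List (List (Fin n))) : List ℕ :=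
  n :: ws.length :: ws.flatMap encodeWord

/-- An instance is represented by listing its forbidden words in any order, each once. -/
def Instance.code {k : ℕ} (x : Instance k) : Set (List ℕ) :=
  {l | ∃ ws : List (List (Fin x.n)),
    ws.Nodup ∧ ws.toFinset = x.acceptor.forbidden ∧ l = encodeWords x.n ws}

end Pangram

/-! A pangram avoiding `F` exists exactly when neither the empty word nor a single letter is
forbidden and the graph of forbidden pairs is acyclic. In a pangram avoiding the pair `xy` the first
occurrence of `y` precedes that of `x`, so first occurrences strictly decrease along walks and
there are no cycles (`criterion_of_hasPangram`). Conversely an acyclic graph has a reverse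
topological sort, obtained from a linear extension of reachability
(`IsAcyclic.exists_isReverseTopologicalSort`), and such a sort is a perfect pangram that avoids
`F`: loops are harmless because no letter is repeated (`IsReverseTopologicalSort.mem_lang`).

Both problems are therefore decided by testing one criterion, which an explicit machine program
does with Kahn's algorithm. Vertices are queued when no unscanned edge leads into them. A queued
vertex has only queued predecessors, so queued vertices are accessible for the edge relation; when
the queue runs empty, each remaining vertex has a remaining predecessor, so none
of them is accessible. Hence all vertices get queued
exactly when the relation is well-founded (`Kahn.Inv.le_length_iff`), which for finite graphs means
acyclic.

The machine needs no space beyond the input, three tables and a few registers: the edges leaving a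
vertex form a linked list whose pointers overwrite the length cells of the forbidden pairs.
Executions are treated with the relation `RAM.Reach`, which records running time and size of numbers
along with the result. The scanning loop either consumes an edge or serves one vertex of the queue,
so the number of unscanned edges plus unserved vertices is a potential bounding its running time
(`RAM.Reach.loop`, `RAM.ScanInv.reach`); `RAM.reach_answered` is the resulting linear bound. -/

namespace Pangram

/-! ### Pangrams and topological sorts -/

section Words

variable {α : Type*}

theorem pair_sublist_of_idxOf_lt [DecidableEq α] {x y : α} {w : List α}
    (h : w.idxOf x < w.idxOf y) (hy : y ∈ w) : [x, y].Sublist w := by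
  induction w with
  | nil => simp at hy
  | cons a w ih =>
    by_cases hx : a = x
    · subst hx
      have hne : a ≠ y := by rintro rfl; simp at h
      have : y ∈ w := by simpa [hne.symm] using hy
      exact (List.singleton_sublist.2 this).cons_cons a
    · by_cases hay : a = y
      · subst hay; simp at h
      · rw [List.idxOf_cons_ne _ hx, List.idxOf_cons_ne _ hay] at h
        exact (ih (by omega) (by simpa [Ne.symm hay] using hy)).cons a

theorem idxOf_le_of_pair_sublist [DecidableEq α] {x y : α} {w : List α} (hw : w.Nodup)
    (h : [x, y].Sublist w) : w.idxOf x ≤ w.idxOf y := by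
  induction w with
  | nil => simp at h
  | cons a w ih =>
    by_cases hx : a = x
    · subst hx; simp
    · have h' : [x, y].Sublist w := by
        rcases List.sublist_cons_iff.1 h with h | ⟨r, hr, -⟩
        · exact h
        · simp only [List.cons.injEq] at hr; exact absurd hr.1.symm hx
      have hy : y ∈ w := h'.subset (by simp)
      have hay : a ≠ y := by rintro rfl; exact (List.nodup_cons.1 hw).1 hy
      rw [List.idxOf_cons_ne _ hx, List.idxOf_cons_ne _ hay]
      exact Nat.succ_le_succ (ih (List.nodup_cons.1 hw).2 h')

theorem IsPerfectPangram.isPangram [DecidableEq α] {w : List α} (h : IsPerfectPangram w) :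
    IsPangram w := fun a => List.count_pos_iff.1 (by rw [h a]; exact one_pos)

theorem IsPerfectPangram.nodup [DecidableEq α] {w : List α} (h : IsPerfectPangram w) :
    w.Nodup := List.nodup_iff_count_le_one.2 fun a => (h a).le

/-- In a pangram avoiding `F`, the first occurrence of `y` precedes that of `x` for every edge
`x → y`, so the position of the first occurrence strictly decreases along walks. -/
theorem criterion_of_hasPangram {k : ℕ} (A : SPT k α) (h : HasPangram A.lang) :
    (∀ u ∈ A.forbidden, ¬ u.length ≤ 1) ∧ IsAcyclic A.graph := by
  classical
  obtain ⟨w, hw, hp⟩ := h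
  refine ⟨fun u hu hl => ?_, fun x hx => ?_⟩
  · refine hw u hu ?_
    match u, hl with
    | [], _ => exact List.nil_sublist w
    | [a], _ => exact List.singleton_sublist.2 (hp a)
  · have key : ∀ y, Relation.TransGen A.graph.Adj x y → w.idxOf y < w.idxOf x := by
      have edge : ∀ a b, A.graph.Adj a b → w.idxOf b < w.idxOf a := by
        rintro a b ⟨hne, hf⟩
        by_contra hle
        refine hw _ hf (pair_sublist_of_idxOf_lt (lt_of_le_of_ne (not_lt.1 hle) ?_) (hp b))
        exact fun he => hne ((List.idxOf_inj (hp a)).1 he)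
      intro y hy
      induction hy with
      | single h => exact edge _ _ h
      | tail _ h ih => exact (edge _ _ h).trans ih
    exact lt_irrefl _ (key x hx)

theorem IsReverseTopologicalSort.mem_lang [DecidableEq α] (A : SPT 2 α)
    (hF : ∀ u ∈ A.forbidden, ¬ u.length ≤ 1) {w : List α}
    (hw : IsReverseTopologicalSort A.graph w) : w ∈ A.lang := by
  intro u hu hsub
  have hlen : u.length = 2 := by
    have := A.length_le u hu
    have := hF u hu
    omega
  obtain ⟨x, y, rfl⟩ := List.length_eq_two.1 hlen
  have hnd : w.Nodup := IsPerfectPangram.nodup hw.1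
  have hne : x ≠ y := by
    rintro rfl
    simpa using hsub.nodup hnd
  exact absurd (hw.2 x y ⟨hne, hu⟩) (not_lt.2 (idxOf_le_of_pair_sublist hnd hsub))

/-- Extend the reachability order of the reversed graph to a linear order and sort the
vertices. -/
theorem IsAcyclic.exists_isReverseTopologicalSort [Fintype α] [DecidableEq α] {G : Digraph α}
    (hG : IsAcyclic G) : ∃ w, IsReverseTopologicalSort G w := by
  classical
  let r : α → α → Prop := fun x y => Relation.ReflTransGen G.Adj y x
  have hr : IsPartialOrder α r :=
    { refl := fun _ => Relation.ReflTransGen.refl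
      trans := fun _ _ _ h₁ h₂ => Relation.ReflTransGen.trans h₂ h₁
      antisymm := fun a b h₁ h₂ => by
        rcases Relation.reflTransGen_iff_eq_or_transGen.1 h₁ with h | h
        · exact h
        · exact absurd (h.trans_left h₂) (hG b) }
  obtain ⟨s, hs, hrs⟩ := extend_partialOrder r
  have hmem : ∀ a, a ∈ Finset.univ.sort s := fun a => by simp
  have hnd : (Finset.univ.sort s).Nodup := Finset.sort_nodup _ _
  refine ⟨Finset.univ.sort s, fun a => List.count_eq_one_of_mem hnd (hmem a), ?_⟩
  intro x y hxy
  have hne : x ≠ y := by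
    rintro rfl
    exact hG x (.single hxy)
  by_contra hle
  have hlt := lt_of_le_of_ne (not_lt.1 hle) fun he => hne ((List.idxOf_inj (hmem x)).1 he)
  have hsub := pair_sublist_of_idxOf_lt hlt (hmem y)
  have hsxy : s x y := by
    simpa using (Finset.pairwise_sort Finset.univ s).sublist hsub
  exact hne (antisymm_of s hsxy (hrs _ _ (Relation.ReflTransGen.single hxy)))

theorem hasPangram_iff_and_hasPerfectPangram_iff [Fintype α] [DecidableEq α] (A : SPT 2 α) :
    (HasPangram A.lang ↔ (∀ u ∈ A.forbidden, ¬ u.length ≤ 1) ∧ IsAcyclic A.graph) ∧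
    (HasPerfectPangram A.lang ↔
      (∀ u ∈ A.forbidden, ¬ u.length ≤ 1) ∧ IsAcyclic A.graph) := by
  have hperf : (∀ u ∈ A.forbidden, ¬ u.length ≤ 1) ∧ IsAcyclic A.graph →
      HasPerfectPangram A.lang := fun ⟨hF, hG⟩ => by
    obtain ⟨w, hw⟩ := hG.exists_isReverseTopologicalSort
    exact ⟨w, hw.mem_lang A hF, hw.1⟩
  have hpan : HasPerfectPangram A.lang → HasPangram A.lang := fun ⟨w, hw, hp⟩ =>
    ⟨w, hw, hp.isPangram⟩
  exact ⟨⟨criterion_of_hasPangram A, fun h => hpan (hperf h)⟩,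
    ⟨fun h => criterion_of_hasPangram A (hpan h), hperf⟩⟩

end Words

/-! ### The invariant of Kahn's algorithm -/

namespace Kahn

variable (src dst : ℕ → ℕ)

/-- The graph whose edges are the non-loops among the pairs `(src j, dst j)` with `j < m`. -/
def Edge (m x y : ℕ) : Prop := ∃ j < m, src j = x ∧ dst j = y ∧ x ≠ y

/-- The indices `j < k` of the edges leaving `x`, the largest first. -/
def out (k x : ℕ) : List ℕ :=
  match k with
  | 0 => []
  | k + 1 => if src k = x ∧ src k ≠ dst k then k :: out k x else out k x

/-- The indices `j < m` of the edges that have not been scanned yet, when the vertices of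
`done` have been removed from the queue and `l` is the unscanned part of the edge list of
the last of them. -/
def pending (m : ℕ) (done l : List ℕ) : Finset ℕ :=
  (Finset.range m).filter fun j => src j ≠ dst j ∧ (src j ∉ done ∨ j ∈ l)

/-- The number of unscanned edges into `y`. -/
def pendingInto (m : ℕ) (done l : List ℕ) (y : ℕ) : ℕ :=
  ((pending src dst m done l).filter fun j => dst j = y).card

/-- The state of Kahn's algorithm on the vertices `0, …, n - 1`: the vertices in `done` have
left the queue, those in `wait` are in it, and `l` lists the unscanned edges of the last vertex
of `done`. A vertex has been queued as soon as no unscanned edge leads into it. -/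
structure Inv (n m : ℕ) (done wait l : List ℕ) : Prop where
  nodup : (done ++ wait).Nodup
  lt : ∀ x ∈ done ++ wait, x < n
  queued_iff : ∀ x < n, x ∈ done ++ wait ↔ pendingInto src dst m done l x = 0
  acc : ∀ x ∈ done ++ wait, Acc (Edge src dst m) x
  nodup_list : l.Nodup
  list : ∀ j ∈ l, j < m ∧ src j ≠ dst j ∧ src j ∈ done

variable {src dst} {n m : ℕ} {done wait l : List ℕ}

theorem mem_out {k x j : ℕ} : j ∈ out src dst k x ↔ j < k ∧ src j = x ∧ src j ≠ dst j := by
  induction k with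
  | zero => simp [out]
  | succ k ih =>
    rw [out]
    split_ifs with h
    · rw [List.mem_cons, ih]
      constructor
      · rintro (rfl | h')
        · exact ⟨Nat.lt_succ_self _, h⟩
        · exact ⟨h'.1.trans (Nat.lt_succ_self _), h'.2⟩
      · rintro ⟨h₁, h₂⟩
        rcases Nat.lt_succ_iff_lt_or_eq.1 h₁ with h₁ | h₁
        · exact .inr ⟨h₁, h₂⟩
        · exact .inl h₁
    · rw [ih]
      constructor
      · exact fun h' => ⟨h'.1.trans (Nat.lt_succ_self _), h'.2⟩
      · rintro ⟨h₁, h₂⟩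
        rcases Nat.lt_succ_iff_lt_or_eq.1 h₁ with h₁ | rfl
        · exact ⟨h₁, h₂⟩
        · exact absurd h₂ h

theorem nodup_out (k x : ℕ) : (out src dst k x).Nodup := by
  induction k with
  | zero => simp [out]
  | succ k ih =>
    rw [out]
    split_ifs
    · exact List.nodup_cons.2 ⟨fun h => lt_irrefl _ (mem_out.1 h).1, ih⟩
    · exact ih

theorem mem_pending {j : ℕ} : j ∈ pending src dst m done l ↔
    j < m ∧ src j ≠ dst j ∧ (src j ∉ done ∨ j ∈ l) := by
  simp [pending]

theorem card_pending_le : (pending src dst m done l).card ≤ m :=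
  (Finset.card_filter_le _ _).trans (Finset.card_range m).le

theorem pendingInto_le (y : ℕ) : pendingInto src dst m done l y ≤ m :=
  (Finset.card_filter_le _ _).trans card_pending_le

theorem pendingInto_eq_zero {y : ℕ} : pendingInto src dst m done l y = 0 ↔
    ∀ j ∈ pending src dst m done l, dst j ≠ y := by
  rw [pendingInto, Finset.card_eq_zero, Finset.filter_eq_empty_iff]

/-- With nothing removed from the queue, the pending edges into `y` are all edges into `y`, and
they can be counted one after the other. -/
theorem pendingInto_nil_succ (k y : ℕ) : pendingInto src dst (k + 1) [] [] y =
    pendingInto src dst k [] [] y + if src k ≠ dst k ∧ dst k = y then 1 else 0 := by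
  unfold pendingInto pending
  rw [Finset.filter_filter, Finset.filter_filter, Finset.range_add_one, Finset.filter_insert]
  by_cases h : src k ≠ dst k ∧ dst k = y
  · rw [if_pos ⟨⟨h.1, .inl (by simp)⟩, h.2⟩, if_pos h, Finset.card_insert_of_notMem (by simp)]
  · rw [if_neg h, if_neg fun h' => h ⟨h'.1.1, h'.2⟩, add_zero]

theorem Inv.length_le (h : Inv src dst n m done wait l) : done.length + wait.length ≤ n := by
  have := List.toFinset_card_of_nodup h.nodup
  rw [← List.length_append, ← this, ← Finset.card_range n]
  exact Finset.card_le_card fun x hx => Finset.mem_range.2 (h.lt x (List.mem_toFinset.1 hx))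

theorem Inv.init : Inv src dst n m []
    ((List.range n).filter fun y => pendingInto src dst m [] [] y = 0) [] where
  nodup := by simpa using List.nodup_range.filter _
  lt := by simp +contextual
  queued_iff := by simp +contextual
  acc x hx := by
    have hx : pendingInto src dst m [] [] x = 0 := by simpa using (List.mem_filter.1 hx).2
    refine Acc.intro x fun y => ?_
    rintro ⟨j, hj, rfl, hd, hne⟩
    exact absurd hd (pendingInto_eq_zero.1 hx j
      (mem_pending.2 ⟨hj, hd ▸ hne, .inl (by simp)⟩))
  nodup_list := List.nodup_nil
  list := by simp

theorem pending_erase {j : ℕ} (hj : src j ∈ done) (hl : j ∉ l) :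
    pending src dst m done l = (pending src dst m done (j :: l)).erase j := by
  ext i
  rw [Finset.mem_erase, mem_pending, mem_pending, List.mem_cons]
  by_cases hi : i = j
  · subst hi; tauto
  · tauto

theorem Inv.mem_pending_cons {j : ℕ} (h : Inv src dst n m done wait (j :: l)) :
    j ∈ pending src dst m done (j :: l) := by
  obtain ⟨h₁, h₂, -⟩ := h.list j (by simp)
  exact mem_pending.2 ⟨h₁, h₂, .inr (by simp)⟩

theorem Inv.card_pending_cons {j : ℕ} (h : Inv src dst n m done wait (j :: l)) :
    (pending src dst m done (j :: l)).card = (pending src dst m done l).card + 1 := by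
  rw [pending_erase (h.list j (by simp)).2.2 (List.nodup_cons.1 h.nodup_list).1,
    Finset.card_erase_add_one h.mem_pending_cons]

theorem Inv.pendingInto_cons {j : ℕ} (h : Inv src dst n m done wait (j :: l)) (y : ℕ) :
    pendingInto src dst m done (j :: l) y =
      pendingInto src dst m done l y + if dst j = y then 1 else 0 := by
  unfold pendingInto
  rw [pending_erase (h.list j (by simp)).2.2 (List.nodup_cons.1 h.nodup_list).1,
    Finset.filter_erase]
  split_ifs with hy
  · rw [Finset.card_erase_add_one (Finset.mem_filter.2 ⟨h.mem_pending_cons, hy⟩)]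
  · rw [Finset.erase_eq_of_notMem (by simp [hy]), add_zero]

theorem Inv.scan {j : ℕ} (h : Inv src dst n m done wait (j :: l))
    (h0 : pendingInto src dst m done l (dst j) ≠ 0) : Inv src dst n m done wait l where
  nodup := h.nodup
  lt := h.lt
  queued_iff x hx := by
    rw [h.queued_iff x hx, h.pendingInto_cons]
    split_ifs with hd
    · subst hd; simp [h0]
    · rfl
  acc := h.acc
  nodup_list := (List.nodup_cons.1 h.nodup_list).2
  list i hi := h.list i (List.mem_cons_of_mem _ hi)

/-- When the last edge into `y` has been scanned, all predecessors of `y` have been queued and are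
accessible, hence so is `y`. -/
theorem Inv.scan_push {j : ℕ} (h : Inv src dst n m done wait (j :: l)) (hn : dst j < n)
    (h0 : pendingInto src dst m done l (dst j) = 0) :
    Inv src dst n m done (wait ++ [dst j]) l where
  nodup := by
    rw [← List.append_assoc]
    refine List.Nodup.append h.nodup (List.nodup_singleton _) ?_
    rw [List.disjoint_singleton, h.queued_iff _ hn, h.pendingInto_cons]
    simp
  lt x hx := by
    rw [← List.append_assoc, List.mem_append, List.mem_singleton] at hx
    rcases hx with hx | rfl
    · exact h.lt x hx
    · exact hn
  queued_iff x hx := by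
    rw [← List.append_assoc, List.mem_append, List.mem_singleton, h.queued_iff x hx,
      h.pendingInto_cons]
    by_cases hd : dst j = x
    · subst hd; simp [h0]
    · simp [hd, Ne.symm hd]
  acc x hx := by
    rw [← List.append_assoc, List.mem_append, List.mem_singleton] at hx
    rcases hx with hx | rfl
    · exact h.acc x hx
    · refine Acc.intro _ fun y => ?_
      rintro ⟨i, hi, rfl, hd, hne⟩
      refine h.acc _ (List.mem_append_left _ ?_)
      by_contra hdone
      exact pendingInto_eq_zero.1 h0 i (mem_pending.2 ⟨hi, hd ▸ hne, .inl hdone⟩) hd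
  nodup_list := (List.nodup_cons.1 h.nodup_list).2
  list i hi := h.list i (List.mem_cons_of_mem _ hi)

theorem Inv.pending_pop {x : ℕ} (h : Inv src dst n m done (x :: wait) []) :
    pending src dst m (done ++ [x]) (out src dst m x) = pending src dst m done [] := by
  have hx : x ∉ done := fun hx => (List.disjoint_of_nodup_append h.nodup) hx (by simp)
  ext j
  simp only [mem_pending, mem_out, List.mem_append, List.mem_singleton, List.not_mem_nil,
    or_false]
  by_cases hj : src j = x
  · subst hj; tauto
  · tauto

theorem Inv.pop {x : ℕ} (h : Inv src dst n m done (x :: wait) []) :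
    Inv src dst n m (done ++ [x]) wait (out src dst m x) where
  nodup := by simpa using h.nodup
  lt := by simpa using h.lt
  queued_iff y hy := by
    unfold pendingInto
    rw [h.pending_pop, List.append_assoc, List.singleton_append]
    exact h.queued_iff y hy
  acc := by simpa using h.acc
  nodup_list := nodup_out m x
  list j hj := by
    obtain ⟨h₁, rfl, h₂⟩ := mem_out.1 hj
    exact ⟨h₁, h₂, by simp⟩

/-- Once the queue is empty, every vertex that was not removed from it has a predecessor that was
not removed either. -/
theorem Inv.le_length_iff (h : Inv src dst n m done [] []) (hsrc : ∀ j < m, src j < n) :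
    n ≤ done.length ↔ ∀ x < n, Acc (Edge src dst m) x := by
  have hnd : done.Nodup := by simpa using h.nodup
  have hsub : done.toFinset ⊆ Finset.range n := fun x hx =>
    Finset.mem_range.2 (h.lt x (by simpa using hx))
  have hcard := List.toFinset_card_of_nodup hnd
  constructor
  · intro hle x hx
    have heq : done.toFinset = Finset.range n :=
      Finset.eq_of_subset_of_card_le hsub (by rw [hcard, Finset.card_range]; exact hle)
    refine h.acc x ?_
    rw [List.append_nil, ← List.mem_toFinset, heq]
    exact Finset.mem_range.2 hx
  · intro hacc
    have hall : ∀ x, Acc (Edge src dst m) x → x < n → x ∈ done := by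
      intro x hx
      induction hx with
      | intro x _ ih =>
        intro hxn
        have := (h.queued_iff x hxn).2
        rw [List.append_nil] at this
        refine this (pendingInto_eq_zero.2 fun j hj hd => ?_)
        obtain ⟨hjm, hne, hj⟩ := mem_pending.1 hj
        have hj : src j ∉ done := by simpa using hj
        exact hj (ih (src j) ⟨j, hjm, rfl, hd, hd ▸ hne⟩ (hsrc j hjm))
    rw [← hcard, ← Finset.card_range n]
    exact Finset.card_le_card fun x hx =>
      List.mem_toFinset.2 (hall x (hacc x (Finset.mem_range.1 hx)) (Finset.mem_range.1 hx))

end Kahn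

/-! ### Executions of random access machines -/

namespace RAM

/-- From `s`, if all its numbers are at most `B`, the program `p` gets into a configuration
satisfying `Q` within `T` steps, and all numbers stay at most `B` on the way. -/
def Reach (p : Program) (B T : ℕ) (s : Config) (Q : Config → Prop) : Prop :=
  s.BoundedBy B → ∃ t ≤ T, Q ((step p)^[t] s) ∧ ∀ i ≤ t, ((step p)^[i] s).BoundedBy B

/-- No number above `B` is written into a register, if all numbers were at most `B` before. -/
def Instr.Safe (B : ℕ) (r : ℕ → ℕ) : Instr → Prop
  | .const _ c => c ≤ B
  | .add _ j k => r j + r k ≤ B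
  | _ => True

theorem Config.BoundedBy.exec {B : ℕ} {s : Config} {ins : Instr} (h : s.BoundedBy B)
    (hs : ins.Safe B s.reg) : (ins.exec s).BoundedBy B := by
  obtain ⟨hr, hm⟩ := h
  have upd : ∀ (f : ℕ → ℕ) (i v : ℕ), (∀ a, f a ≤ B) → v ≤ B →
      ∀ a, Function.update f i v a ≤ B := by
    intro f i v hf hv a
    rw [Function.update_apply]
    split_ifs
    exacts [hv, hf a]
  cases ins with
  | const i c => exact ⟨upd _ _ _ hr hs, hm⟩
  | move i j => exact ⟨upd _ _ _ hr (hr j), hm⟩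
  | add i j k => exact ⟨upd _ _ _ hr hs, hm⟩
  | sub i j k => exact ⟨upd _ _ _ hr ((Nat.sub_le _ _).trans (hr j)), hm⟩
  | load i j => exact ⟨upd _ _ _ hr (hm _), hm⟩
  | store i j => exact ⟨hr, upd _ _ _ hm (hr j)⟩
  | jump l => exact ⟨hr, hm⟩
  | jumpIfZero i l => exact ⟨hr, hm⟩

variable {p : Program} {B T : ℕ} {s : Config} {Q : Config → Prop}

theorem Reach.done (h : Q s) : Reach p B T s Q := fun hb =>
  ⟨0, T.zero_le, h, fun i hi => by rw [Nat.le_zero.1 hi]; exact hb⟩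

theorem Reach.step {ins : Instr} (hp : p[s.pc]? = some ins) (hs : ins.Safe B s.reg)
    (h : Reach p B T (ins.exec s) Q) : Reach p B (T + 1) s Q := fun hb => by
  have hstep : RAM.step p s = ins.exec s := by rw [RAM.step, hp]
  obtain ⟨t, ht, hq, hbd⟩ := h (hb.exec hs)
  refine ⟨t + 1, Nat.succ_le_succ ht, ?_, fun i hi => ?_⟩
  · rwa [Function.iterate_succ_apply, hstep]
  · cases i with
    | zero => exact hb
    | succ i =>
      rw [Function.iterate_succ_apply, hstep]
      exact hbd i (Nat.succ_le_succ_iff.1 hi)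

theorem Reach.branch {i l : ℕ} (hp : p[s.pc]? = some (.jumpIfZero i l))
    (h0 : s.reg i = 0 → Reach p B T ⟨l, s.reg, s.mem⟩ Q)
    (h1 : s.reg i ≠ 0 → Reach p B T ⟨s.pc + 1, s.reg, s.mem⟩ Q) : Reach p B (T + 1) s Q := by
  refine Reach.step hp trivial ?_
  by_cases h : s.reg i = 0
  · simpa [Instr.exec, h] using h0 h
  · simpa [Instr.exec, h] using h1 h

theorem Reach.trans {T' : ℕ} {R : Config → Prop} (h : Reach p B T s R)
    (h' : ∀ s', R s' → Reach p B T' s' Q) : Reach p B (T + T') s Q := fun hb => by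
  obtain ⟨t, ht, hr, hbd⟩ := h hb
  obtain ⟨t', ht', hq, hbd'⟩ := h' _ hr (hbd t le_rfl)
  refine ⟨t + t', Nat.add_le_add ht ht', ?_, fun i hi => ?_⟩
  · rwa [Nat.add_comm, Function.iterate_add_apply]
  · rcases le_total i t with hit | hit
    · exact hbd i hit
    · obtain ⟨d, rfl⟩ := Nat.exists_eq_add_of_le hit
      rw [Nat.add_comm, Function.iterate_add_apply]
      exact hbd' d (by omega)

theorem Reach.mono {T' : ℕ} {R : Config → Prop} (h : Reach p B T s R) (hT : T ≤ T')
    (hQ : ∀ s', R s' → Q s') : Reach p B T' s Q := fun hb => by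
  obtain ⟨t, ht, hr, hbd⟩ := h hb
  exact ⟨t, ht.trans hT, hQ _ hr, hbd⟩

/-- A loop whose body takes at most `c` steps and either leaves the loop or decreases the
potential `Φ` ends within `c * (Φ + 1)` steps. -/
theorem Reach.loop {c : ℕ} (I : ℕ → Config → Prop)
    (h : ∀ Φ s, I Φ s → Reach p B c s fun s' => Q s' ∨ ∃ Φ' < Φ, I Φ' s') (Φ : ℕ) :
    ∀ s, I Φ s → Reach p B (c * (Φ + 1)) s Q := by
  induction Φ using Nat.strong_induction_on with
  | _ Φ ih =>
    intro s hs
    refine (Reach.trans (T' := c * Φ) (h Φ s hs) ?_).mono (by rw [Nat.mul_succ]; omega)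
      fun _ => id
    rintro s' (hq | ⟨Φ', hlt, hI⟩)
    · exact Reach.done hq
    · exact (ih Φ' hlt s' hI).mono (Nat.mul_le_mul_left c hlt) fun _ => id

/-! ### The program -/

/-- Kahn's algorithm. Registers `r₁, r₂, r₃` hold the constants `1, 2, 3`, register `r₄` holds
the number `n` of letters, and `r₆, r₇, r₈` the addresses of three tables behind the
input: the heads of the edge lists, the numbers of unscanned edges into each letter, and the queue.
The edges leaving a letter form a linked list: the cell that held the length of a forbidden pair
is reused for the address of the next one. Instructions 0-10 compute the constants, 11-34 read
the forbidden words, 35-46 fill the queue with the letters without incoming edges, 47-68 scan the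
edges and serve the queue, and 69-71 compare the number of queued letters with `n`. -/
def program : Program := [
  .load 4 0, .const 1 1, .load 5 1, .const 2 2, .const 3 3,
  .add 6 5 5, .add 6 6 5, .add 6 6 2, .add 7 6 4, .add 8 7 4, .move 9 2,
  -- 11: the edge at address `r₉`
  .sub 10 6 9, .jumpIfZero 10 35, .load 10 9, .sub 10 2 10, .jumpIfZero 10 17, .jump 72,
  .add 11 9 1, .load 12 11, .add 11 11 1, .load 13 11,
  .sub 10 12 13, .sub 11 13 12, .add 10 10 11, .jumpIfZero 10 33,
  .add 12 6 12, .load 10 12, .store 9 10, .store 12 9,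
  .add 13 7 13, .load 10 13, .add 10 10 1, .store 13 10,
  .add 9 9 3, .jump 11,
  -- 35: the letter `r₁₁`, the end `r₁₂` of the queue
  .const 11 0, .move 12 8,
  .sub 10 4 11, .jumpIfZero 10 47, .add 10 7 11, .load 10 10, .jumpIfZero 10 43, .jump 45,
  .store 12 11, .add 12 12 1, .add 11 11 1, .jump 37,
  -- 47: the unscanned edges `r₉`, the front `r₁₃` and the end `r₁₂` of the queue
  .move 13 8, .move 9 0,
  .jumpIfZero 9 62, .add 10 9 2, .load 10 10, .add 11 7 10, .load 14 11, .sub 14 14 1,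
  .store 11 14, .load 9 9, .jumpIfZero 14 59, .jump 49, .store 12 10, .add 12 12 1, .jump 49,
  .sub 10 12 13, .jumpIfZero 10 69, .load 10 13, .add 13 13 1, .add 10 6 10, .load 9 10,
  .jump 49,
  -- 69: the answer
  .sub 12 12 8, .sub 4 4 12, .sub 0 1 4]

/-- The linked list that starts at the value `a` consists of the edges in the given list; `0` is
the null pointer, and edge number `j` has address `3 * j + 2`. -/
def Chain (μ : ℕ → ℕ) (a : ℕ) : List ℕ → Prop
  | [] => a = 0
  | j :: l => a = 3 * j + 2 ∧ Chain μ (μ a) l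

theorem Chain.congr {μ ν : ℕ → ℕ} {a : ℕ} {l : List ℕ} (h : Chain μ a l)
    (hν : ∀ j ∈ l, ν (3 * j + 2) = μ (3 * j + 2)) : Chain ν a l := by
  induction l generalizing a with
  | nil => exact h
  | cons j l ih =>
    obtain ⟨rfl, h⟩ := h
    refine ⟨rfl, ?_⟩
    rw [hν j (by simp)]
    exact ih h fun i hi => hν i (List.mem_cons_of_mem _ hi)

section Tables

variable (M : ℕ → ℕ) (n m : ℕ)

/-- The first letter of the `j`-th pair in the memory `M`. -/
abbrev src (j : ℕ) : ℕ := M (3 * j + 3)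

/-- The second letter of the `j`-th pair in the memory `M`. -/
abbrev dst (j : ℕ) : ℕ := M (3 * j + 4)

/-- The registers that stay fixed after the initialization. -/
structure Fixed (r : ℕ → ℕ) : Prop where
  r0 : r 0 = 0
  r1 : r 1 = 1
  r2 : r 2 = 2
  r3 : r 3 = 3
  r4 : r 4 = n
  r6 : r 6 = 3 * m + 2
  r7 : r 7 = 3 * m + 2 + n
  r8 : r 8 = 3 * m + 2 + n + n

/-- The memory after the first `k` edges of the input `M` have been put into the edge lists, with
`deg` in the table of degrees. -/
structure Tables (k : ℕ) (deg : ℕ → ℕ) (μ : ℕ → ℕ) : Prop where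
  input : ∀ a < 3 * m + 2, (∀ j < k, a ≠ 3 * j + 2) → μ a = M a
  out : ∀ x < n, Chain μ (μ (3 * m + 2 + x)) (Kahn.out (src M) (dst M) k x)
  deg : ∀ y < n, μ (3 * m + 2 + n + y) = deg y

variable {M n m} {k : ℕ} {deg μ : ℕ → ℕ}

/-- Registers from `9` on are scratch registers. -/
theorem Fixed.update {r : ℕ → ℕ} (h : Fixed n m r) {i : ℕ} (hi : 9 ≤ i) (v : ℕ) :
    Fixed n m (Function.update r i v) := by
  obtain ⟨h0, h1, h2, h3, h4, h6, h7, h8⟩ := h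
  constructor <;> rw [Function.update_of_ne (by omega)] <;> assumption

theorem Tables.store_queue (h : Tables M n m k deg μ) (hk : k ≤ m) {a : ℕ}
    (ha : 3 * m + 2 + n + n ≤ a) (v : ℕ) : Tables M n m k deg (Function.update μ a v) where
  input b hb hj := by
    rw [Function.update_of_ne (by omega)]
    exact h.input b hb hj
  out x hx := by
    rw [Function.update_of_ne (by omega)]
    refine (h.out x hx).congr fun j hj => Function.update_of_ne ?_ _ _
    have := (Kahn.mem_out.1 hj).1
    omega
  deg y hy := by
    rw [Function.update_of_ne (by omega)]
    exact h.deg y hy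

theorem Tables.store_deg (h : Tables M n m k deg μ) (hk : k ≤ m) (y v : ℕ) :
    Tables M n m k (Function.update deg y v)
      (Function.update μ (3 * m + 2 + n + y) v) where
  input b hb hj := by
    rw [Function.update_of_ne (by omega)]
    exact h.input b hb hj
  out x hx := by
    rw [Function.update_of_ne (by omega)]
    refine (h.out x hx).congr fun j hj => Function.update_of_ne ?_ _ _
    have := (Kahn.mem_out.1 hj).1
    omega
  deg z hz := by
    rw [Function.update_apply, Function.update_apply]
    by_cases hzy : z = y
    · simp [hzy]
    · rw [if_neg (by omega), if_neg hzy]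
      exact h.deg z hz

theorem Tables.skip (h : Tables M n m k deg μ) (hk : src M k = dst M k) :
    Tables M n m (k + 1) deg μ where
  input a ha hj := h.input a ha fun j hjk => hj j (by omega)
  out x hx := by
    rw [Kahn.out, if_neg fun h' => h'.2 hk]
    exact h.out x hx
  deg := h.deg

/-- Inserting edge `k` at the front of the list of its source. -/
theorem Tables.link (h : Tables M n m k deg μ) (hkm : k < m) (hn : src M k < n)
    (hk : src M k ≠ dst M k) :
    Tables M n m (k + 1) deg (Function.update
      (Function.update μ (3 * k + 2) (μ (3 * m + 2 + src M k))) (3 * m + 2 + src M k)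
      (3 * k + 2)) where
  input a ha hj := by
    have := hj k (Nat.lt_succ_self k)
    rw [Function.update_of_ne (by omega), Function.update_of_ne (by omega)]
    exact h.input a ha fun j hjk => hj j (by omega)
  out x hx := by
    have old : ∀ j ∈ Kahn.out (src M) (dst M) k x, Function.update
        (Function.update μ (3 * k + 2) (μ (3 * m + 2 + src M k))) (3 * m + 2 + src M k)
        (3 * k + 2) (3 * j + 2) = μ (3 * j + 2) := fun j hj => by
      have := (Kahn.mem_out.1 hj).1
      rw [Function.update_of_ne (by omega), Function.update_of_ne (by omega)]
    by_cases hx' : src M k = x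
    · subst hx'
      rw [Kahn.out, if_pos ⟨rfl, hk⟩, Function.update_self]
      refine ⟨rfl, ?_⟩
      rw [Function.update_of_ne (by omega), Function.update_self]
      exact (h.out _ hx).congr old
    · rw [Kahn.out, if_neg fun h' => hx' h'.1, Function.update_of_ne (by omega),
        Function.update_of_ne (by omega)]
      exact (h.out x hx).congr old
  deg y hy := by
    rw [Function.update_of_ne (by omega), Function.update_of_ne (by omega)]
    exact h.deg y hy

end Tables

/-! ### Reading the forbidden words -/

variable {M : ℕ → ℕ} {n m : ℕ}

/-- The invariant at instruction 11, after `k` forbidden words. -/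
structure ReadInv (M : ℕ → ℕ) (n m k : ℕ) (s : Config) : Prop where
  pc : s.pc = 11
  fixed : Fixed n m s.reg
  r9 : s.reg 9 = 3 * k + 2
  le : k ≤ m
  pairs : ∀ j < k, M (3 * j + 2) = 2
  tables : Tables M n m k (Kahn.pendingInto (src M) (dst M) k [] []) s.mem

theorem reach_readInv (h0 : M 0 = n) (h1 : M 1 = m) (hz : ∀ a, 3 * m + 2 ≤ a → M a = 0) :
    Reach program (4 * (m + n + 1)) 11 ⟨0, fun _ => 0, M⟩ (ReadInv M n m 0) := by
  refine Reach.step rfl trivial ?_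
  refine Reach.step rfl (by simp only [Instr.Safe]; omega) ?_
  refine Reach.step rfl trivial ?_
  refine Reach.step rfl (by simp only [Instr.Safe]; omega) ?_
  refine Reach.step rfl (by simp only [Instr.Safe]; omega) ?_
  refine Reach.step rfl (by simp [Instr.Safe, Instr.exec, h0, h1]; omega) ?_
  refine Reach.step rfl (by simp [Instr.Safe, Instr.exec, h0, h1]; omega) ?_
  refine Reach.step rfl (by simp [Instr.Safe, Instr.exec, h0, h1]; omega) ?_
  refine Reach.step rfl (by simp [Instr.Safe, Instr.exec, h0, h1]; omega) ?_
  refine Reach.step rfl (by simp [Instr.Safe, Instr.exec, h0, h1]; omega) ?_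
  refine Reach.step rfl trivial ?_
  refine Reach.done ⟨rfl, ?_, ?_, m.zero_le, by simp, ?_⟩
  · constructor <;> simp [Instr.exec, h0, h1] <;> omega
  · simp [Instr.exec]
  · refine ⟨fun _ _ _ => rfl, fun x _ => ?_, fun y _ => ?_⟩
    · exact hz _ (by omega)
    · exact hz _ (by omega)

/-- What the forbidden words in the memory `M` satisfy as long as all words before them are pairs:
their length is at most `2`, and the letters of pairs are smaller than `n`. -/
def ValidInput (M : ℕ → ℕ) (n m : ℕ) : Prop :=
  ∀ k < m, (∀ j < k, M (3 * j + 2) = 2) →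
    M (3 * k + 2) ≤ 2 ∧ (M (3 * k + 2) = 2 → src M k < n ∧ dst M k < n)

/-- The forbidden words have been read, and all of them are pairs. -/
structure ReadDone (M : ℕ → ℕ) (n m : ℕ) (s : Config) : Prop where
  pc : s.pc = 35
  fixed : Fixed n m s.reg
  pairs : ∀ j < m, M (3 * j + 2) = 2
  tables : Tables M n m m (Kahn.pendingInto (src M) (dst M) m [] []) s.mem

/-- A word that is not a pair has been found. -/
structure Rejected (M : ℕ → ℕ) (m : ℕ) (s : Config) : Prop where
  pc : s.pc = 72
  r0 : s.reg 0 = 0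
  not_pairs : ¬ ∀ j < m, M (3 * j + 2) = 2

/-- Reading one forbidden word: it is rejected if it is not a pair, skipped if it is a loop, and
put into the tables otherwise. -/
theorem ReadInv.reach (hv : ValidInput M n m) {k : ℕ} {s : Config} (h : ReadInv M n m k s) :
    Reach program (4 * (m + n + 1)) 24 s fun s' => (ReadDone M n m s' ∨ Rejected M m s') ∨
      k < m ∧ ReadInv M n m (k + 1) s' := by
  obtain ⟨pc, r, μ⟩ := s
  obtain ⟨hpc, hf, h9, hk, hpairs, ht⟩ := h
  obtain rfl : pc = 11 := hpc
  dsimp only at hf h9 ht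
  obtain ⟨r0, r1, r2, r3, r4, r6, r7, r8⟩ := id hf
  refine Reach.step rfl trivial ?_
  refine Reach.branch rfl (fun hz => ?_) fun hz => ?_
  all_goals
    simp only [Instr.exec, Function.update_self, r6, h9] at hz
    dsimp only [Instr.exec]
  -- all words have been read
  · obtain rfl : k = m := by omega
    exact Reach.done (.inl (.inl ⟨rfl, hf.update (i := 10) (by norm_num) _, hpairs, ht⟩))
  have hkm : k < m := by omega
  obtain ⟨hlen, hlt⟩ := hv k hkm hpairs
  have hMlen : μ (3 * k + 2) = M (3 * k + 2) := ht.input _ (by omega) fun j hj => by omega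
  have hMx : μ (3 * k + 2 + 1) = src M k := ht.input _ (by omega) fun j hj => by omega
  have hMy : μ (3 * k + 2 + 1 + 1) = dst M k := ht.input _ (by omega) fun j hj => by omega
  refine Reach.step rfl trivial ?_
  refine Reach.step rfl trivial ?_
  refine Reach.branch rfl (fun hz => ?_) fun hz => ?_
  all_goals
    simp [Instr.exec, r2, h9, hMlen] at hz
    dsimp only [Instr.exec]
  swap
  · refine Reach.step rfl trivial (Reach.done (.inl (.inr ⟨rfl, ?_, fun h => ?_⟩)))
    · simp [Instr.exec, r0]
    · have := h k hkm
      omega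
  -- from here on the word is a pair
  have h2 : M (3 * k + 2) = 2 := by omega
  obtain ⟨hx, hy⟩ := hlt h2
  refine Reach.step rfl (by simp [Instr.Safe, r1, h9]; omega) ?_
  refine Reach.step rfl trivial ?_
  refine Reach.step rfl (by simp [Instr.Safe, Instr.exec, r1, h9]; omega) ?_
  refine Reach.step rfl trivial ?_
  refine Reach.step rfl trivial ?_
  refine Reach.step rfl trivial ?_
  refine Reach.step rfl (by simp [Instr.Safe, Instr.exec, r1, h9, hMx, hMy]; omega) ?_
  have hpairs' : ∀ j < k + 1, M (3 * j + 2) = 2 := fun j hj => by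
    rcases Nat.lt_succ_iff_lt_or_eq.1 hj with hj | rfl
    exacts [hpairs j hj, h2]
  refine Reach.branch rfl (fun hz => ?_) fun hz => ?_
  -- the sum of the two truncated differences of the letters vanishes exactly for loops
  all_goals
    simp [Instr.exec, r1, h9, hMx, hMy] at hz
    simp only [Instr.exec]
  · have heq : src M k = dst M k := by omega
    refine Reach.step rfl (by simp [Instr.Safe, r3, h9]; omega) ?_
    refine Reach.step rfl trivial (Reach.done (.inr ⟨hkm, rfl, ?_, ?_, hkm, hpairs', ?_⟩))
    · simp only [Instr.exec]
      repeat' refine Fixed.update ?_ (by norm_num) _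
      exact hf
    · simp [Instr.exec, r3, h9]; omega
    · have hsame : Kahn.pendingInto (src M) (dst M) (k + 1) [] [] =
          Kahn.pendingInto (src M) (dst M) k [] [] := funext fun y => by
        rw [Kahn.pendingInto_nil_succ, if_neg fun h => h.1 heq, add_zero]
      rw [hsame]
      exact ht.skip heq
  · have hne : src M k ≠ dst M k := by omega
    have hdeg := ht.deg _ hy
    have hdegle : Kahn.pendingInto (src M) (dst M) k [] [] (dst M k) ≤ k :=
      Kahn.pendingInto_le _
    refine Reach.step rfl (by simp [Instr.Safe, r1, r6, h9, hMx]; omega) ?_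
    refine Reach.step rfl trivial ?_
    refine Reach.step rfl trivial ?_
    refine Reach.step rfl trivial ?_
    refine Reach.step rfl (by simp [Instr.Safe, Instr.exec, r1, r7, h9, hMy]; omega) ?_
    refine Reach.step rfl trivial ?_
    -- linking the edge has not touched the table of degrees
    have key : ∀ a b, Function.update (Function.update μ (3 * k + 2) a) (3 * m + 2 + src M k) b
        (3 * m + 2 + n + dst M k) = Kahn.pendingInto (src M) (dst M) k [] [] (dst M k) :=
      fun a b => by
        rw [Function.update_of_ne (by omega), Function.update_of_ne (by omega), hdeg]
    refine Reach.step rfl (by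
      simp [Instr.Safe, Instr.exec, r1, r6, r7, h9, hMx, hMy, key]; omega) ?_
    refine Reach.step rfl trivial ?_
    refine Reach.step rfl (by simp [Instr.Safe, Instr.exec, r3, h9]; omega) ?_
    refine Reach.step rfl trivial (Reach.done (.inr ⟨hkm, rfl, ?_, ?_, hkm, hpairs', ?_⟩))
    · simp only [Instr.exec]
      repeat' refine Fixed.update ?_ (by norm_num) _
      exact hf
    · simp [Instr.exec, r3, h9]; omega
    · simp [Instr.exec, r1, r6, r7, h9, hMx, hMy, key]
      convert (ht.link hkm hx hne).store_deg hkm (dst M k) _ using 1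
      funext y
      rw [Kahn.pendingInto_nil_succ, Function.update_apply]
      by_cases hd : y = dst M k
      · subst hd; simp [hne]
      · rw [if_neg hd, if_neg fun h => hd h.2.symm, add_zero]

/-! ### Filling the queue and scanning the edges -/

/-- The list `q` is stored from address `a` on. -/
def Stored (μ : ℕ → ℕ) (a : ℕ) (q : List ℕ) : Prop := ∀ t x, q[t]? = some x → μ (a + t) = x

theorem Stored.store_lt {μ : ℕ → ℕ} {a b : ℕ} {q : List ℕ} (h : Stored μ a q) (hb : b < a)
    (v : ℕ) : Stored (Function.update μ b v) a q := fun t x hx => by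
  rw [Function.update_of_ne (by omega)]
  exact h t x hx

theorem Stored.push {μ : ℕ → ℕ} {a : ℕ} {q : List ℕ} (h : Stored μ a q) (v : ℕ) :
    Stored (Function.update μ (a + q.length) v) a (q ++ [v]) := fun t x hx => by
  rcases lt_trichotomy t q.length with ht | rfl | ht
  · rw [Function.update_of_ne (by omega)]
    rw [List.getElem?_append_left ht] at hx
    exact h t x hx
  · simpa using hx
  · rw [List.getElem?_eq_none (by simp; omega)] at hx
    cases hx

/-- The letters below `i` without incoming edges. -/
def sources (M : ℕ → ℕ) (m i : ℕ) : List ℕ :=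
  (List.range i).filter fun y => Kahn.pendingInto (src M) (dst M) m [] [] y = 0

theorem sources_succ (i : ℕ) : sources M m (i + 1) =
    if Kahn.pendingInto (src M) (dst M) m [] [] i = 0 then sources M m i ++ [i]
    else sources M m i := by
  rw [sources, List.range_succ, List.filter_append]
  split_ifs with h <;> simp [sources, h]

theorem length_sources_le (i : ℕ) : (sources M m i).length ≤ i :=
  (List.length_filter_le _ _).trans (List.length_range).le

/-- The invariant at instruction 37: the letters below `i` have been examined. -/
structure FillInv (M : ℕ → ℕ) (n m i : ℕ) (s : Config) : Prop where
  pc : s.pc = 37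
  fixed : Fixed n m s.reg
  r11 : s.reg 11 = i
  le : i ≤ n
  r12 : s.reg 12 = 3 * m + 2 + n + n + (sources M m i).length
  tables : Tables M n m m (Kahn.pendingInto (src M) (dst M) m [] []) s.mem
  queue : Stored s.mem (3 * m + 2 + n + n) (sources M m i)

/-- The queue contains the letters without incoming edges. -/
structure FillDone (M : ℕ → ℕ) (n m : ℕ) (s : Config) : Prop where
  pc : s.pc = 47
  fixed : Fixed n m s.reg
  r12 : s.reg 12 = 3 * m + 2 + n + n + (sources M m n).length
  tables : Tables M n m m (Kahn.pendingInto (src M) (dst M) m [] []) s.mem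
  queue : Stored s.mem (3 * m + 2 + n + n) (sources M m n)

theorem ReadDone.reach {s : Config} (h : ReadDone M n m s) :
    Reach program (4 * (m + n + 1)) 2 s (FillInv M n m 0) := by
  obtain ⟨pc, r, μ⟩ := s
  obtain ⟨hpc, hf, -, ht⟩ := h
  obtain rfl : pc = 35 := hpc
  refine Reach.step rfl (Nat.zero_le _) ?_
  refine Reach.step rfl trivial (Reach.done ⟨rfl, ?_, ?_, n.zero_le, ?_, ht, ?_⟩)
  · simp only [Instr.exec]
    repeat' refine Fixed.update ?_ (by norm_num) _
    exact hf
  · simp [Instr.exec]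
  · simpa [Instr.exec, sources] using hf.r8
  · intro t x hx
    simp [sources] at hx

/-- Examining one letter. -/
theorem FillInv.reach {i : ℕ} {s : Config} (h : FillInv M n m i s) :
    Reach program (4 * (m + n + 1)) 9 s fun s' => FillDone M n m s' ∨
      i < n ∧ FillInv M n m (i + 1) s' := by
  obtain ⟨pc, r, μ⟩ := s
  obtain ⟨hpc, hf, h11, hi, h12, ht, hq⟩ := h
  obtain rfl : pc = 37 := hpc
  dsimp only at hf h11 h12 ht hq
  obtain ⟨r0, r1, r2, r3, r4, r6, r7, r8⟩ := id hf
  have hlen := length_sources_le (M := M) (m := m) i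
  refine Reach.step rfl trivial ?_
  refine Reach.branch rfl (fun hz => ?_) fun hz => ?_
  all_goals
    simp only [Instr.exec, Function.update_self, r4, h11] at hz
    dsimp only [Instr.exec]
  · obtain rfl : i = n := by omega
    exact Reach.done (.inl ⟨rfl, hf.update (i := 10) (by norm_num) _, by simp [h12], ht, hq⟩)
  have hin : i < n := by omega
  have hdeg := ht.deg i hin
  refine Reach.step rfl (by simp [Instr.Safe, r7, h11]; omega) ?_
  refine Reach.step rfl trivial ?_
  refine Reach.branch rfl (fun hz => ?_) fun hz => ?_
  all_goals
    simp [Instr.exec, r7, h11, hdeg] at hz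
    simp only [Instr.exec]
  · have hs := sources_succ (M := M) (m := m) i
    rw [if_pos hz] at hs
    refine Reach.step rfl trivial ?_
    refine Reach.step rfl (by simp [Instr.Safe, Instr.exec, r1, h12]; omega) ?_
    refine Reach.step rfl (by simp [Instr.Safe, Instr.exec, r1, h11]; omega) ?_
    refine Reach.step rfl trivial (Reach.done (.inr ⟨hin, rfl, ?_, ?_, hin, ?_, ?_, ?_⟩))
    · simp only [Instr.exec]
      repeat' refine Fixed.update ?_ (by norm_num) _
      exact hf
    · simp [Instr.exec, r1, h11]
    · simp [Instr.exec, r1, h12, hs]; omega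
    · simp only [Instr.exec]
      exact ht.store_queue le_rfl (by simp [h12]) _
    · rw [hs]
      simpa [Instr.exec, h11, h12] using hq.push i
  · have hs := sources_succ (M := M) (m := m) i
    rw [if_neg hz] at hs
    refine Reach.step rfl trivial ?_
    refine Reach.step rfl (by simp [Instr.Safe, Instr.exec, r1, h11]; omega) ?_
    refine Reach.step rfl trivial (Reach.done (.inr ⟨hin, rfl, ?_, ?_, hin, ?_, ht, ?_⟩))
    · simp only [Instr.exec]
      repeat' refine Fixed.update ?_ (by norm_num) _
      exact hf
    · simp [Instr.exec, r1, h11]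
    · simp [Instr.exec, h12, hs]
    · rw [hs]
      exact hq

/-- The invariant at instruction 49, in the state `done`, `wait`, `l` of Kahn's algorithm. -/
structure ScanInv (M : ℕ → ℕ) (n m : ℕ) (done wait l : List ℕ) (s : Config) : Prop where
  pc : s.pc = 49
  fixed : Fixed n m s.reg
  chain : Chain s.mem (s.reg 9) l
  r12 : s.reg 12 = 3 * m + 2 + n + n + (done ++ wait).length
  r13 : s.reg 13 = 3 * m + 2 + n + n + done.length
  tables : Tables M n m m (Kahn.pendingInto (src M) (dst M) m done l) s.mem
  queue : Stored s.mem (3 * m + 2 + n + n) (done ++ wait)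
  inv : Kahn.Inv (src M) (dst M) n m done wait l

/-- The queue is empty and all edges leaving the letters of `done` have been scanned. -/
structure ScanDone (M : ℕ → ℕ) (n m : ℕ) (s : Config) : Prop where
  pc : s.pc = 69
  fixed : Fixed n m s.reg
  exists_inv : ∃ done, s.reg 12 = 3 * m + 2 + n + n + done.length ∧
    Kahn.Inv (src M) (dst M) n m done [] []

theorem FillDone.reach {s : Config} (h : FillDone M n m s) :
    Reach program (4 * (m + n + 1)) 2 s (ScanInv M n m [] (sources M m n) []) := by
  obtain ⟨pc, r, μ⟩ := s
  obtain ⟨hpc, hf, h12, ht, hq⟩ := h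
  obtain rfl : pc = 47 := hpc
  dsimp only at hf h12 ht hq
  refine Reach.step rfl trivial ?_
  refine Reach.step rfl trivial (Reach.done ⟨rfl, ?_, ?_, ?_, ?_, ht, hq, Kahn.Inv.init⟩)
  · simp only [Instr.exec]
    repeat' refine Fixed.update ?_ (by norm_num) _
    exact hf
  · simp [Instr.exec, Chain, hf.r0]
  · simp [Instr.exec, h12]
  · simp [Instr.exec, hf.r8]

/-- Scanning one edge. -/
theorem ScanInv.reach_scan (hdst : ∀ j < m, dst M j < n) {done wait l : List ℕ} {j : ℕ}
    {s : Config} (h : ScanInv M n m done wait (j :: l) s) :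
    Reach program (4 * (m + n + 1)) 12 s fun s' => ∃ wait', ScanInv M n m done wait' l s' := by
  obtain ⟨pc, r, μ⟩ := s
  obtain ⟨hpc, hf, ⟨h9, hc⟩, h12, h13, ht, hq, hinv⟩ := h
  obtain rfl : pc = 49 := hpc
  dsimp only at hf h9 hc h12 h13 ht hq
  obtain ⟨r0, r1, r2, r3, r4, r6, r7, r8⟩ := id hf
  have hjm : j < m := (hinv.list j (by simp)).1
  have hy := hdst j hjm
  have hMy : μ (3 * j + 2 + 2) = dst M j := ht.input _ (by omega) fun i hi => by omega
  have hdeg := ht.deg _ hy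
  rw [hinv.pendingInto_cons, if_pos rfl] at hdeg
  -- the memory after the decrement
  set ν := Function.update μ (3 * m + 2 + n + dst M j)
    (Kahn.pendingInto (src M) (dst M) m done l (dst M j)) with hν
  have hνt : Tables M n m m (Kahn.pendingInto (src M) (dst M) m done l) ν := by
    convert ht.store_deg le_rfl (dst M j) _ using 1
    funext y
    rw [Function.update_apply]
    by_cases hd : y = dst M j
    · rw [if_pos hd, hd]
    · rw [if_neg hd, hinv.pendingInto_cons, if_neg (Ne.symm hd), add_zero]
  have hνq : Stored ν (3 * m + 2 + n + n) (done ++ wait) := hq.store_lt (by omega) _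
  have hνj : ν (3 * j + 2) = μ (3 * j + 2) := Function.update_of_ne (by omega) _ _
  have hνc : Chain ν (ν (3 * j + 2)) l := by
    rw [hνj, ← h9]
    refine hc.congr fun i hi => Function.update_of_ne ?_ _ _
    have := (hinv.list i (List.mem_cons_of_mem _ hi)).1
    omega
  -- addresses of edges are positive, so a nonempty list is not mistaken for the null pointer
  refine Reach.branch rfl (fun hz => by simp only [h9] at hz; omega) fun _ => ?_
  refine Reach.step rfl (by simp [Instr.Safe, r2, h9]; omega) ?_
  refine Reach.step rfl trivial ?_
  refine Reach.step rfl (by simp [Instr.Safe, Instr.exec, r2, r7, h9, hMy]; omega) ?_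
  refine Reach.step rfl trivial ?_
  refine Reach.step rfl trivial ?_
  refine Reach.step rfl trivial ?_
  refine Reach.step rfl trivial ?_
  have hmem : Function.update μ (3 * m + 2 + n + dst M j)
    (μ (3 * m + 2 + n + dst M j) - 1) = ν := by rw [hdeg, hν, Nat.add_sub_cancel]
  simp [Instr.exec, r1, r2, r7, h9, hMy, hmem]
  refine Reach.branch rfl (fun hz => ?_) fun hz => ?_
  all_goals
    simp [hdeg] at hz
    simp only
  · have hpush := hinv.scan_push hy hz
    have hlen := hpush.length_le
    rw [List.length_append, List.length_singleton] at hlen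
    refine Reach.step rfl trivial ?_
    refine Reach.step rfl (by simp [Instr.Safe, Instr.exec, r1, h12]; omega) ?_
    refine Reach.step rfl trivial (Reach.done
      ⟨wait ++ [dst M j], rfl, ?_, ?_, ?_, ?_, ?_, ?_, hpush⟩)
    · simp only [Instr.exec]
      repeat' refine Fixed.update ?_ (by norm_num) _
      exact hf
    · simp [Instr.exec, h12]
      refine hνc.congr fun i hi => Function.update_of_ne ?_ _ _
      have := (hinv.list i (List.mem_cons_of_mem _ hi)).1
      omega
    · simp [Instr.exec, r1, h12]; omega
    · simp [Instr.exec, h13]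
    · simp only [Instr.exec]
      exact hνt.store_queue le_rfl (by simp [h12]) _
    · rw [← List.append_assoc]
      simpa [Instr.exec, h12] using hνq.push (dst M j)
  · refine Reach.step rfl trivial (Reach.done
      ⟨wait, rfl, ?_, ?_, ?_, ?_, hνt, hνq, hinv.scan hz⟩)
    · simp only [Instr.exec]
      repeat' refine Fixed.update ?_ (by norm_num) _
      exact hf
    · simpa [Instr.exec] using hνc
    · simp [Instr.exec, h12]
    · simp [Instr.exec, h13]

/-- Serving the queue. -/
theorem ScanInv.reach_pop {done wait : List ℕ} {s : Config}
    (h : ScanInv M n m done wait [] s) :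
    Reach program (4 * (m + n + 1)) 8 s fun s' => ScanDone M n m s' ∨
      ∃ x wait', wait = x :: wait' ∧
        ScanInv M n m (done ++ [x]) wait' (Kahn.out (src M) (dst M) m x) s' := by
  obtain ⟨pc, r, μ⟩ := s
  obtain ⟨hpc, hf, h9, h12, h13, ht, hq, hinv⟩ := h
  obtain rfl : pc = 49 := hpc
  dsimp only [Chain] at hf h9 h12 h13 ht hq
  obtain ⟨r0, r1, r2, r3, r4, r6, r7, r8⟩ := id hf
  have hlen := hinv.length_le
  refine Reach.branch rfl (fun _ => ?_) fun hz => absurd h9 hz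
  refine Reach.step rfl trivial ?_
  cases wait with
  | nil =>
    refine Reach.branch rfl (fun _ => ?_) fun hz => ?_
    · refine Reach.done (.inl ⟨rfl, hf.update (i := 10) (by norm_num) _, done, ?_, hinv⟩)
      simp [Instr.exec, h12]
    · simp [Instr.exec, h12, h13] at hz
  | cons x wait =>
    rw [List.length_cons] at hlen
    have hx : x < n := hinv.lt x (by simp)
    have hμx : μ (3 * m + 2 + n + n + done.length) = x := hq _ _ (by simp)
    refine Reach.branch rfl (fun hz => ?_) fun _ => ?_
    · simp [Instr.exec, h12, h13] at hz
      omega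
    refine Reach.step rfl trivial ?_
    refine Reach.step rfl (by simp [Instr.Safe, Instr.exec, r1, h13]; omega) ?_
    refine Reach.step rfl (by simp [Instr.Safe, Instr.exec, r6, h13, hμx]; omega) ?_
    refine Reach.step rfl trivial ?_
    refine Reach.step rfl trivial (Reach.done
      (.inr ⟨x, wait, rfl, rfl, ?_, ?_, ?_, ?_, ?_, ?_, hinv.pop⟩))
    · simp only [Instr.exec]
      repeat' refine Fixed.update ?_ (by norm_num) _
      exact hf
    · simpa [Instr.exec, r6, h13, hμx] using ht.out x hx
    · simp [Instr.exec, h12]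
    · simp [Instr.exec, r1, h13]; omega
    · have hsame : Kahn.pendingInto (src M) (dst M) m (done ++ [x])
          (Kahn.out (src M) (dst M) m x) = Kahn.pendingInto (src M) (dst M) m done [] := by
        funext y
        rw [Kahn.pendingInto, Kahn.pendingInto, hinv.pending_pop]
      rw [hsame]
      exact ht
    · rw [List.append_assoc]
      exact hq

/-- The number of steps of Kahn's algorithm is bounded by the number of unscanned edges plus the
number of letters that have not left the queue. -/
theorem ScanInv.reach (hdst : ∀ j < m, dst M j < n) {done wait l : List ℕ} {s : Config}
    (h : ScanInv M n m done wait l s) :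
    Reach program (4 * (m + n + 1))
      (12 * ((Kahn.pending (src M) (dst M) m done l).card + (n - done.length) + 1)) s
      (ScanDone M n m) := by
  refine Reach.loop (fun Φ s => ∃ done wait l, ScanInv M n m done wait l s ∧
    Φ = (Kahn.pending (src M) (dst M) m done l).card + (n - done.length)) ?_ _ s
    ⟨done, wait, l, h, rfl⟩
  rintro _ s ⟨done, wait, l, h, rfl⟩
  cases l with
  | nil =>
    refine h.reach_pop.mono (by norm_num) fun s' hs' => hs'.imp_right ?_
    rintro ⟨x, wait', rfl, h'⟩
    refine ⟨_, ?_, _, _, _, h', rfl⟩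
    have := h.inv.length_le
    rw [h.inv.pending_pop, List.length_append, List.length_singleton]
    rw [List.length_cons] at this
    omega
  | cons j l =>
    refine (h.reach_scan hdst).mono le_rfl fun s' ⟨wait', h'⟩ => .inr ⟨_, ?_, _, _, _, h', rfl⟩
    rw [h.inv.card_pending_cons]
    omega

/-- The program has halted with the answer to the question whether all forbidden words are pairs
and their graph is well-founded. -/
structure Answered (M : ℕ → ℕ) (n m : ℕ) (s : Config) : Prop where
  pc : s.pc = 72
  answer : s.reg 0 ≠ 0 ↔
    (∀ j < m, M (3 * j + 2) = 2) ∧ ∀ x < n, Acc (Kahn.Edge (src M) (dst M) m) x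

theorem ScanDone.reach (hpairs : ∀ j < m, M (3 * j + 2) = 2) (hsrc : ∀ j < m, src M j < n)
    {s : Config} (h : ScanDone M n m s) :
    Reach program (4 * (m + n + 1)) 3 s (Answered M n m) := by
  obtain ⟨pc, r, μ⟩ := s
  obtain ⟨hpc, hf, done, h12, hinv⟩ := h
  obtain rfl : pc = 69 := hpc
  dsimp only at hf h12
  refine Reach.step rfl trivial ?_
  refine Reach.step rfl trivial ?_
  refine Reach.step rfl trivial (Reach.done ⟨rfl, ?_⟩)
  rw [← hinv.le_length_iff hsrc, and_iff_right hpairs]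
  simp [Instr.exec, hf.r1, hf.r4, hf.r8, h12]
  omega

/-- All addresses lie below `3 * m + 2 + 3 * n`, and degrees are at most `m`, so no number exceeds
`4 * (m + n + 1)`; the three loops have potentials `m`, `n` and at most `m + n`. -/
theorem reach_answered (hv : ValidInput M n m) (h0 : M 0 = n) (h1 : M 1 = m)
    (hz : ∀ a, 3 * m + 2 ≤ a → M a = 0) :
    Reach program (4 * (m + n + 1)) (75 * (m + n + 1)) ⟨0, fun _ => 0, M⟩ (Answered M n m) := by
  have hread : Reach program (4 * (m + n + 1)) (11 + 24 * (m + 1)) ⟨0, fun _ => 0, M⟩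
      fun s => ReadDone M n m s ∨ Rejected M m s := by
    refine (reach_readInv h0 h1 hz).trans fun s hs => ?_
    refine Reach.loop (fun Φ s => ∃ k, ReadInv M n m k s ∧ Φ = m - k) ?_ m s ⟨0, hs, rfl⟩
    rintro _ s ⟨k, hk, rfl⟩
    exact (hk.reach hv).mono le_rfl fun s' => Or.imp_right
      fun ⟨hkm, h⟩ => ⟨m - (k + 1), by omega, k + 1, h, rfl⟩
  refine (hread.trans (T' := 2 + (9 * (n + 1) + (2 + (12 * (m + n + 1) + 3)))) ?_).mono
    (by omega) fun _ => id
  rintro s (hs | hs)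
  · have hlt : ∀ j < m, src M j < n ∧ dst M j < n := fun j hj =>
      (hv j hj fun i hi => hs.pairs i (hi.trans hj)).2 (hs.pairs j hj)
    refine hs.reach.trans fun s' h' => ?_
    refine Reach.trans (R := FillDone M n m) ?_ fun s'' h'' => h''.reach.trans fun s₃ h₃ => ?_
    · refine Reach.loop (fun Φ s => ∃ i, FillInv M n m i s ∧ Φ = n - i) ?_ n s' ⟨0, h', rfl⟩
      rintro _ s ⟨i, hi, rfl⟩
      exact hi.reach.mono le_rfl fun s' => Or.imp_right
        fun ⟨hin, h⟩ => ⟨n - (i + 1), by omega, i + 1, h, rfl⟩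
    · refine Reach.trans (R := ScanDone M n m)
        ((h₃.reach fun j hj => (hlt j hj).2).mono ?_ fun _ => id)
        fun s₄ h₄ => h₄.reach hs.pairs fun j hj => (hlt j hj).1
      have := Kahn.card_pending_le (src := src M) (dst := dst M) (m := m) (done := []) (l := [])
      rw [List.length_nil]
      omega
  · exact Reach.done ⟨hs.pc, by simp [hs.r0, hs.not_pairs]⟩

/-! ### Encoded instances -/

theorem length_flatMap_encodeWord_le {n : ℕ} (ws : List (List (Fin n)))
    (h : ∀ u ∈ ws, u.length ≤ 2) : (ws.flatMap encodeWord).length ≤ 3 * ws.length := by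
  induction ws with
  | nil => simp
  | cons u ws ih =>
    have h1 := ih fun v hv => h v (List.mem_cons_of_mem _ hv)
    have h2 := h u (by simp)
    simp only [List.flatMap_cons, List.length_append, encodeWord, List.length_cons,
      List.length_map]
    omega

/-- Behind `k` pairs, word number `k` starts at position `3 * k`. -/
theorem getD_flatMap_encodeWord {n : ℕ} (ws : List (List (Fin n))) {k : ℕ} (hk : k < ws.length)
    (h : ∀ j (hj : j < k), (ws[j]).length = 2) {i : ℕ} (hi : i ≤ (ws[k]).length) :
    (ws.flatMap encodeWord).getD (3 * k + i) 0 = (encodeWord ws[k]).getD i 0 := by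
  induction k generalizing ws with
  | zero =>
    obtain ⟨u, ws, rfl⟩ := List.exists_cons_of_length_pos hk
    simp only [List.getElem_cons_zero] at hi ⊢
    rw [List.flatMap_cons, List.getD_append _ _ _ _ (by simp [encodeWord]; omega)]
    simp
  | succ k ih =>
    obtain ⟨u, ws, rfl⟩ := List.exists_cons_of_length_pos (Nat.zero_lt_of_lt hk)
    have hu : u.length = 2 := h 0 k.succ_pos
    simp only [List.getElem_cons_succ] at hi ⊢
    rw [List.flatMap_cons, List.getD_append_right _ _ _ _ (by simp [encodeWord, hu]; omega)]
    rw [← ih ws (by simpa using hk) (fun j hj => h (j + 1) (by omega)) hi]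
    congr 1
    simp [encodeWord, hu]
    omega

section Encoding

variable {n : ℕ} {ws : List (List (Fin n))}

/-- The memory in which the forbidden words `ws` are stored. -/
abbrev inputMem (n : ℕ) (ws : List (List (Fin n))) (a : ℕ) : ℕ := (encodeWords n ws).getD a 0

theorem inputMem_length {k : ℕ} (hk : k < ws.length)
    (h : ∀ j (hj : j < k), (ws[j]).length = 2) :
    inputMem n ws (3 * k + 2) = (ws[k]).length :=
  getD_flatMap_encodeWord ws hk h (Nat.zero_le _)

theorem inputMem_letters {k : ℕ} (hk : k < ws.length)
    (h : ∀ j (hj : j < k), (ws[j]).length = 2) {x y : Fin n} (hxy : ws[k] = [x, y]) :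
    src (inputMem n ws) k = x ∧ dst (inputMem n ws) k = y := by
  have h1 := getD_flatMap_encodeWord ws hk h (i := 1) (by simp [hxy])
  have h2 := getD_flatMap_encodeWord ws hk h (i := 2) (by simp [hxy])
  rw [hxy] at h1 h2
  exact ⟨h1, h2⟩

theorem length_eq_two_of_inputMem {k : ℕ} (hk : k ≤ ws.length)
    (h : ∀ j < k, inputMem n ws (3 * j + 2) = 2) (j : ℕ) (hj : j < k) :
    (ws[j]).length = 2 := by
  induction j using Nat.strong_induction_on with
  | _ j ih =>
    rw [← inputMem_length (by omega) fun i hi => ih i hi (hi.trans hj)]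
    exact h j hj

theorem forall_inputMem_iff : (∀ j < ws.length, inputMem n ws (3 * j + 2) = 2) ↔
    ∀ u ∈ ws, u.length = 2 := by
  constructor
  · intro h u hu
    obtain ⟨j, hj, rfl⟩ := List.mem_iff_getElem.1 hu
    exact length_eq_two_of_inputMem le_rfl h j hj
  · intro h j hj
    rw [inputMem_length hj fun i hi => h _ (List.getElem_mem _)]
    exact h _ (List.getElem_mem _)

theorem validInput_inputMem (hle : ∀ u ∈ ws, u.length ≤ 2) :
    ValidInput (inputMem n ws) n ws.length := by
  intro k hk h
  have hpairs := length_eq_two_of_inputMem hk.le h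
  rw [inputMem_length hk hpairs]
  refine ⟨hle _ (List.getElem_mem _), fun h2 => ?_⟩
  obtain ⟨x, y, hxy⟩ := List.length_eq_two.1 h2
  obtain ⟨h1, h2⟩ := inputMem_letters hk hpairs hxy
  rw [h1, h2]
  exact ⟨x.2, y.2⟩

theorem inputMem_eq_zero (hle : ∀ u ∈ ws, u.length ≤ 2) {a : ℕ} (ha : 3 * ws.length + 2 ≤ a) :
    inputMem n ws a = 0 := by
  have := length_flatMap_encodeWord_le ws hle
  refine List.getD_eq_default _ _ ?_
  simp only [encodeWords, List.length_cons]
  omega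

theorem inputMem_le (hle : ∀ u ∈ ws, u.length ≤ 2) (a : ℕ) :
    inputMem n ws a ≤ 4 * (ws.length + n + 1) := by
  have hmem : ∀ v ∈ encodeWords n ws, v ≤ 4 * (ws.length + n + 1) := by
    intro v hv
    simp only [encodeWords, encodeWord, List.mem_cons, List.mem_flatMap, List.mem_map] at hv
    rcases hv with rfl | rfl | ⟨u, hu, rfl | ⟨x, -, rfl⟩⟩
    · omega
    · omega
    · have := hle u hu
      omega
    · have := x.2
      omega
  rcases lt_or_ge a (encodeWords n ws).length with ha | ha
  · rw [inputMem, List.getD_eq_getElem _ _ ha]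
    exact hmem _ (List.getElem_mem _)
  · rw [inputMem, List.getD_eq_default _ _ ha]
    exact Nat.zero_le _

theorem edge_inputMem_iff (hpairs : ∀ u ∈ ws, u.length = 2) {a b : ℕ} :
    Kahn.Edge (src (inputMem n ws)) (dst (inputMem n ws)) ws.length a b ↔
      ∃ x y : Fin n, x.val = a ∧ y.val = b ∧ x ≠ y ∧ [x, y] ∈ ws := by
  have hp : ∀ j (hj : j < ws.length), (ws[j]).length = 2 := fun j hj =>
    hpairs _ (List.getElem_mem _)
  constructor
  · rintro ⟨j, hj, rfl, rfl, hne⟩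
    obtain ⟨x, y, hxy⟩ := List.length_eq_two.1 (hp j hj)
    obtain ⟨h1, h2⟩ := inputMem_letters hj (fun i hi => hp i (hi.trans hj)) hxy
    rw [h1, h2] at hne
    exact ⟨x, y, h1.symm, h2.symm, fun h => hne (congrArg Fin.val h),
      hxy ▸ List.getElem_mem _⟩
  · rintro ⟨x, y, rfl, rfl, hne, hmem⟩
    obtain ⟨j, hj, hxy⟩ := List.mem_iff_getElem.1 hmem
    obtain ⟨h1, h2⟩ := inputMem_letters hj (fun i hi => hp i (hi.trans hj)) hxy
    exact ⟨j, hj, h1, h2, fun h => hne (Fin.ext h)⟩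

/-- On a finite vertex set, a graph is acyclic exactly when its edge relation is well-founded. -/
theorem isAcyclic_iff_wellFounded {α : Type*} [Finite α] (G : Digraph α) :
    IsAcyclic G ↔ WellFounded G.Adj := by
  constructor
  · intro h
    have : IsTrans α (Relation.TransGen G.Adj) := ⟨fun _ _ _ => Relation.TransGen.trans⟩
    have : Std.Irrefl (Relation.TransGen G.Adj) := ⟨h⟩
    exact Subrelation.wf (Relation.TransGen.single)
      (Finite.wellFounded_of_trans_of_irrefl (Relation.TransGen G.Adj))
  · exact fun h x hx => h.transGen.irrefl.irrefl x hx

theorem forall_acc_edge_iff (A : SPT 2 (Fin n)) (hws : ws.toFinset = A.forbidden)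
    (hpairs : ∀ u ∈ ws, u.length = 2) :
    (∀ a < n, Acc (Kahn.Edge (src (inputMem n ws)) (dst (inputMem n ws)) ws.length) a) ↔
      IsAcyclic A.graph := by
  have hadj : ∀ x y : Fin n, A.graph.Adj x y ↔ x ≠ y ∧ [x, y] ∈ ws := fun x y => by
    rw [← List.mem_toFinset, hws]
    rfl
  rw [isAcyclic_iff_wellFounded]
  constructor
  · intro h
    refine Subrelation.wf (fun {x y} hxy => ?_) (⟨fun x => ?_⟩ : WellFounded
      (InvImage (Kahn.Edge (src (inputMem n ws)) (dst (inputMem n ws)) ws.length) Fin.val))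
    · exact (edge_inputMem_iff hpairs).2 ⟨x, y, rfl, rfl, (hadj x y).1 hxy⟩
    · exact InvImage.accessible Fin.val (h x x.2)
  · intro h
    have hacc : ∀ x : Fin n,
        Acc (Kahn.Edge (src (inputMem n ws)) (dst (inputMem n ws)) ws.length) x.val := by
      intro x
      induction x using h.induction with
      | _ x ih =>
        refine Acc.intro _ fun a ha => ?_
        obtain ⟨y, z, rfl, hz, hyz⟩ := (edge_inputMem_iff hpairs).1 ha
        obtain rfl : z = x := Fin.ext hz
        exact ih y ((hadj y z).2 hyz)
    exact fun a ha => hacc ⟨a, ha⟩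

end Encoding

/-- The criterion for the existence of a pangram is decided by the program. -/
theorem solvableInLinearTime_criterion :
    SolvableInLinearTime (ι := Instance 2) Instance.code Instance.size fun x =>
      (∀ u ∈ x.acceptor.forbidden, ¬ u.length ≤ 1) ∧ IsAcyclic x.acceptor.graph := by
  refine ⟨program, 75, ?_⟩
  rintro ⟨n, A⟩ _ ⟨ws, hnd, hws, rfl⟩
  dsimp only at ws hws ⊢
  have hmem : ∀ u, u ∈ ws ↔ u ∈ A.forbidden := fun u => by rw [← List.mem_toFinset, hws]
  have hle : ∀ u ∈ ws, u.length ≤ 2 := fun u hu => A.length_le u ((hmem u).1 hu)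
  have hsize : Instance.size ⟨n, A⟩ = ws.length + n := by
    rw [Instance.size, ← hws, List.toFinset_card_of_nodup hnd]
  rw [hsize]
  obtain ⟨t, ht, ⟨hpc, hans⟩, hbd⟩ := reach_answered (validInput_inputMem hle) rfl rfl
    (fun a ha => inputMem_eq_zero hle ha) ⟨fun _ => Nat.zero_le _, inputMem_le hle⟩
  refine ⟨t, ht, ?_, ?_, fun s hs => ?_⟩
  · exact hpc.ge
  · refine hans.trans ?_
    rw [forall_inputMem_iff]
    have hlen : (∀ u ∈ ws, u.length = 2) ↔ ∀ u ∈ A.forbidden, ¬ u.length ≤ 1 := by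
      refine forall_congr' fun u => ?_
      rw [← hmem]
      refine forall_congr' fun hu => ?_
      have := hle u hu
      omega
    rw [← hlen]
    exact and_congr_right fun hpairs => forall_acc_edge_iff A hws hpairs
  · obtain ⟨hr, hm⟩ := hbd s hs
    exact ⟨fun i => (hr i).trans (by omega), fun a => (hm a).trans (by omega)⟩

theorem SolvableInLinearTime.congr {ι : Type*} {code : ι → Set (List ℕ)} {size : ι → ℕ}
    {P Q : ι → Prop} (h : SolvableInLinearTime code size P) (hPQ : ∀ x, P x ↔ Q x) :
    SolvableInLinearTime code size Q := by
  rwa [← funext fun x => propext (hPQ x)]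

end RAM

end Pangram

theorem mainTheorem11 :
    -- both problems are solvable in linear time
    Pangram.RAM.SolvableInLinearTime (ι := Pangram.Instance 2) Pangram.Instance.code
      Pangram.Instance.size (fun x => Pangram.HasPangram x.acceptor.lang) ∧
    Pangram.RAM.SolvableInLinearTime (ι := Pangram.Instance 2) Pangram.Instance.code
      Pangram.Instance.size (fun x => Pangram.HasPerfectPangram x.acceptor.lang) ∧
    ∀ (α : Type*) [Fintype α] [DecidableEq α] (A : Pangram.SPT 2 α),
      -- criterion for the existence of a pangram and of a perfect pangram
      (Pangram.HasPangram A.lang ↔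
        (∀ u ∈ A.forbidden, ¬ u.length ≤ 1) ∧ Pangram.IsAcyclic A.graph) ∧
      (Pangram.HasPerfectPangram A.lang ↔
        (∀ u ∈ A.forbidden, ¬ u.length ≤ 1) ∧ Pangram.IsAcyclic A.graph) ∧
      -- reverse topological sorts then exist, and each is a perfect pangram in the language
      ((∀ u ∈ A.forbidden, ¬ u.length ≤ 1) → Pangram.IsAcyclic A.graph →
        (∃ w, Pangram.IsReverseTopologicalSort A.graph w) ∧
        ∀ w, Pangram.IsReverseTopologicalSort A.graph w →
          w ∈ A.lang ∧ Pangram.IsPangram w ∧ Pangram.IsPerfectPangram w) := by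
  refine ⟨?_, ?_, fun α _ _ A => ?_⟩
  · exact Pangram.RAM.solvableInLinearTime_criterion.congr fun x =>
      (Pangram.hasPangram_iff_and_hasPerfectPangram_iff x.acceptor).1.symm
  · exact Pangram.RAM.solvableInLinearTime_criterion.congr fun x =>
      (Pangram.hasPangram_iff_and_hasPerfectPangram_iff x.acceptor).2.symm
  · obtain ⟨h₁, h₂⟩ := Pangram.hasPangram_iff_and_hasPerfectPangram_iff A
    refine ⟨h₁, h₂, fun hF hG => ⟨hG.exists_isReverseTopologicalSort, fun w hw => ?_⟩⟩
    have hp : Pangram.IsPerfectPangram w := hw.1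
    exact ⟨hw.mem_lang A hF, hp.isPangram, hp⟩
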